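/- Fix an integer $N_s\ge 1$, and reals $\mathcal E>0$, $\mathcal N_0>0$, and put $\gamma=\mathcal E/\mathcal N_0$. Consider systems with $K\ge 1$ users and $N=N_sN_h$ chips, the chips being divided into $N_s$ subgroups of $N_h$ contiguous chips, and the channel $\mathbf y=\mathbf S\mathbf b+\mathbf n$, where: - $\mathbf S=[\mathbf s_1,\dots,\mathbf s_K]\in\mathbb R^{N\times K}$ is a random time-hopping matrix: independently for every user and every subgroup, the column $\mathbf s_k$ has exactly one nonzero entry in the subgroup, at a uniformly distributed position, equal to $+1/\sqrt{N_s}$ or $-1/\sqrt{N_s}$ with probability $1/2$ each; - $\mathbf b=(b_1,\dots,b_K)$ has i.i.d. circularly symmetric complex Gaussian entries $b_k\sim\mathcal{CN}(0,\mathcal E)$; - $\mathbf n\in\mathbb C^N$ is circularly symmetric complex Gaussian with mean zero and covariance $\mathcal N_0\mathbf I$; - $\mathbf S$, $\mathbf b$, $\mathbf n$ are independent. Let $\mathsf y_1=\mathbf s_1^{\mathsf T}\mathbf y$ be the output of the single-user matched filter of user $1$ (or of any other user, with the same conclusions), let $\rho_{1k}=\mathbf s_1^{\mathsf T}\mathbf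 s_k$, and let $I(\mathsf y_1;b_1|\mathbf S)$ be the conditional mutual information given $\mathbf S$, in bits. In the large-system limit, i.e. along any sequence of such systems with $N_s$ fixed, $N_h\to\infty$ and $K/N\to\beta\in[0,\infty)$, the quantity $I(\mathsf y_1;b_1|\mathbf S)$ is finite for every system and $$ I(\mathsf y_1;b_1|\mathbf S)\;\longrightarrow\;\sum_{k\ge0}\frac{(N_s^2\beta)^k}{k!}e^{-N_s^2\beta}\log_2\!\Big(1+\frac{\gamma}{1+\frac{k}{N_s^2}\gamma}\Big), $$ where the series converges; hence the mutual information of the system in b/s/Hz satisfies $$ \frac KN\, I(\mathsf y_1;b_1|\mathbf S)\;\longrightarrow\;\beta\sum_{k\ge0}\frac{(N_s^2\beta)^k}{k!}e^{-N_s^2\beta}\log_2\!\Big(1+\frac{\gamma}{1+\frac{k}{N_s^2}\gamma}\Big). $$ Moreover, the interference energy $\sum_{k=2}^K\rho_{1k}^2$ converges in distribution to $X/N_s^2$, where $X$ is a Poisson random variable with mean $N_s^2\beta$. -/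

import Mathlib

open MeasureTheory ProbabilityTheory Filter Topology
open scoped NNReal ENNReal Matrix

noncomputable section

namespace THCDMA

/-- Real matrices carry the product Borel σ-algebra. -/
instance instMeasurableSpaceRealMatrix {m n : Type*} : MeasurableSpace (Matrix m n ℝ) :=
  inferInstanceAs (MeasurableSpace (m → n → ℝ))

/-! ### Information measures -/

/-- Conditional mutual information `I(X ; Y | Z)`, in nats: the expectation over `Z` of the
Kullback-Leibler divergence of the conditional joint law of `(X, Y)` given `Z` from the product
of the conditional laws of `X` and of `Y` given `Z`. -/
def condMutualInfo {Ω 𝓧 𝓨 𝓩 : Type*} [MeasurableSpace Ω]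
    [MeasurableSpace 𝓧] [StandardBorelSpace 𝓧] [Nonempty 𝓧]
    [MeasurableSpace 𝓨] [StandardBorelSpace 𝓨] [Nonempty 𝓨] [MeasurableSpace 𝓩]
    (X : Ω → 𝓧) (Y : Ω → 𝓨) (Z : Ω → 𝓩) (P : Measure Ω) [IsFiniteMeasure P] : ℝ≥0∞ :=
  ∫⁻ z, InformationTheory.klDiv (condDistrib (fun ω => (X ω, Y ω)) Z P z)
    ((condDistrib X Z P z).prod (condDistrib Y Z P z)) ∂(P.map Z)

/-- The circularly symmetric complex Gaussian law with mean `0` and variance `v`: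
independent real and imaginary parts, each of law `N(0, v / 2)`. -/
def circularGaussian (v : ℝ≥0) : Measure ℂ :=
  ((gaussianReal 0 (v / 2)).prod (gaussianReal 0 (v / 2))).map
    (fun p : ℝ × ℝ => (⟨p.1, p.2⟩ : ℂ))

/-! ### Time-hopping spreading -/

/-- The `N = Ns * Nh` chips are split into `Ns` subgroups of `Nh` contiguous chips; subgroup `m`
consists of the chips `m * Nh, …, m * Nh + Nh - 1`. Given for every subgroup a position and a
sign, this is the sequence whose only nonzero entry in subgroup `m` is at the chosen position
and equals `± 1 / √Ns` according to the chosen sign (`true` for `+`). -/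
def thSequence {Ns Nh : ℕ} (c : Fin Ns → Fin Nh × Bool) : Fin (Ns * Nh) → ℝ := fun i =>
  if (c (finProdFinEquiv.symm i).1).1 = (finProdFinEquiv.symm i).2 then
    (if (c (finProdFinEquiv.symm i).1).2 then 1 else -1) / √(Ns : ℝ)
  else 0

/-- The matrix whose `k`-th column is the sequence of user `k`. -/
def thMatrix {Ns Nh K : ℕ} (c : Fin K → Fin Ns → Fin Nh × Bool) :
    Matrix (Fin (Ns * Nh)) (Fin K) ℝ :=
  Matrix.of fun i k => thSequence (c k) i

/-- The law of a random time-hopping matrix: for every user and every subgroup, independently,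
the pulse position is uniform among the `Nh` chips and the sign is uniform. -/
def thMatrixLaw (Ns Nh K : ℕ) : Measure (Matrix (Fin (Ns * Nh)) (Fin K) ℝ) :=
  (Measure.pi fun _ : Fin K => Measure.pi fun _ : Fin Ns =>
    uniformOn (Set.univ : Set (Fin Nh × Bool))).map thMatrix

/-! ### The channel and the matched filters -/

/-- The received vector `y = S b + n`. -/
def received {N K : ℕ} (S : Matrix (Fin N) (Fin K) ℝ) (b : Fin K → ℂ) (n : Fin N → ℂ) :
    Fin N → ℂ :=
  S.map (fun x : ℝ => (x : ℂ)) *ᵥ b + n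

/-- The output `s_uᵀ y` of the matched filter of user `u`. -/
def matchedFilter {N K : ℕ} (S : Matrix (Fin N) (Fin K) ℝ) (u : Fin K) (y : Fin N → ℂ) : ℂ :=
  (fun i => (S i u : ℂ)) ⬝ᵥ y

/-- The cross-correlation `ρ_{uk} = s_uᵀ s_k`. -/
def crossCorr {N K : ℕ} (S : Matrix (Fin N) (Fin K) ℝ) (u k : Fin K) : ℝ :=
  (fun i => S i u) ⬝ᵥ (fun i => S i k)

/-- The interference energy `∑_{k ≠ u} ρ_{uk}²` seen by user `u`. -/
def interferenceEnergy {N K : ℕ} (S : Matrix (Fin N) (Fin K) ℝ) (u : Fin K) : ℝ :=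
  ∑ k ∈ Finset.univ.erase u, crossCorr S u k ^ 2

/-- A time-hopping system with `K` users, `Ns` subgroups of `Nh` chips, and Gaussian inputs:
the spreading matrix, the symbols and the noise are independent random variables, the symbols
are i.i.d. circular complex Gaussian of variance `E`, and the noise is circular complex
Gaussian with covariance `N₀ I`. -/
structure IsGaussianTHSystem {Ω : Type*} [MeasurableSpace Ω] (P : Measure Ω)
    (Ns Nh K : ℕ) (E N₀ : ℝ≥0) (S : Ω → Matrix (Fin (Ns * Nh)) (Fin K) ℝ)
    (b : Ω → Fin K → ℂ) (n : Ω → Fin (Ns * Nh) → ℂ) : Prop where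
  measurable_matrix : Measurable S
  measurable_symbols : Measurable b
  measurable_noise : Measurable n
  law_matrix : P.map S = thMatrixLaw Ns Nh K
  law_symbols : P.map b = Measure.pi fun _ => circularGaussian E
  law_noise : P.map n = Measure.pi fun _ => circularGaussian N₀
  indep_matrix : IndepFun S (fun ω => (b ω, n ω)) P
  indep_symbols_noise : IndepFun b n P

/-- `I(y_u ; b_u | S)` in bits per channel use, where `y_u` is the matched-filter output of
user `u`. It takes values in `[0, ∞]`. -/
def sumfMutualInfo {Ω : Type*} [MeasurableSpace Ω] (P : Measure Ω) [IsFiniteMeasure P]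
    {N K : ℕ} (S : Ω → Matrix (Fin N) (Fin K) ℝ) (b : Ω → Fin K → ℂ) (n : Ω → Fin N → ℂ)
    (u : Fin K) : ℝ≥0∞ :=
  condMutualInfo (fun ω => matchedFilter (S ω) u (received (S ω) (b ω) (n ω)))
    (fun ω => b ω u) S P / ENNReal.ofReal (Real.log 2)

/-- The `k`-th term `e^{-Ns² β} (Ns² β)^k / k! * log₂ (1 + γ / (1 + k γ / Ns²))`. -/
def poissonRateTerm (Ns : ℕ) (β γ : ℝ) (k : ℕ) : ℝ :=
  Real.exp (-((Ns : ℝ) ^ 2 * β)) * ((Ns : ℝ) ^ 2 * β) ^ k / (k.factorial : ℝ) *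
    Real.logb 2 (1 + γ / (1 + (k : ℝ) / (Ns : ℝ) ^ 2 * γ))

end THCDMA

end

noncomputable section

namespace THCDMA

/-! ### Circular Gaussian laws -/

/-! Freeze a spreading matrix with `‖s_u‖ = 1`, which holds almost surely. The matched filter then
outputs `b_u + Z`, where `Z` collects the other symbols and the noise. `Z` is circular Gaussian,
independent of `b_u`, of variance `x E + N₀` with `x` the interference energy. The mutual
information with `b_u` is therefore exactly `log (1 + E / (x E + N₀))` (`klDiv_matchedFilter`).
Since the matrix is independent of symbols and noise, averaging over it gives the conditional mutual
information as the mean of `rate γ` at the interference energy (`sumfMutualInfo_eq`). As `rate γ` is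
bounded and continuous, everything reduces to the limit law of that energy.

Fix the sequence `d` of user `u`. The other `K - 1` squared correlations are then i.i.d. Each of the
`Ns` subgroups gives a pulse match with probability `1 / Nh`. A single match gives the value `1 /
Ns²` whatever the signs, and two or more matches have probability `O(Nh⁻²)`. Hence the
characteristic function of one squared correlation is `1 + (Ns / Nh) (e^{it/Ns²} - 1) + O(Nh⁻²)`,
uniformly in `d` (`norm_corrCharFun_sub_le`). Since `(K - 1) / Nh → Ns β`, its power `K - 1` tends
to `exp (Ns² β (e^{it/Ns²} - 1))`, the characteristic function of a Poisson variable divided by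
`Ns²`. Lévy's continuity theorem concludes. -/

theorem measurable_complexMk : Measurable (fun p : ℝ × ℝ => (⟨p.1, p.2⟩ : ℂ)) :=
  Complex.measurableEquivRealProd.symm.measurable

instance isProbabilityMeasure_circularGaussian (v : ℝ≥0) :
    IsProbabilityMeasure (circularGaussian v) :=
  Measure.isProbabilityMeasure_map measurable_complexMk.aemeasurable

theorem charFun_circularGaussian (v : ℝ≥0) (w : ℂ) :
    charFun (circularGaussian v) w = Complex.exp (-(v * ‖w‖ ^ 2 / 4)) := by
  have hre := charFun_gaussianReal (μ := 0) (v := v / 2) w.re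
  have him := charFun_gaussianReal (μ := 0) (v := v / 2) w.im
  rw [charFun_apply] at hre him ⊢
  rw [circularGaussian, integral_map measurable_complexMk.aemeasurable (by fun_prop)]
  have key : ∀ p : ℝ × ℝ, Complex.exp (((inner ℝ (⟨p.1, p.2⟩ : ℂ) w : ℝ) : ℂ) * Complex.I)
      = Complex.exp (((inner ℝ p.1 w.re : ℝ) : ℂ) * Complex.I) *
        Complex.exp (((inner ℝ p.2 w.im : ℝ) : ℂ) * Complex.I) := by
    intro p
    rw [← Complex.exp_add, ← add_mul, ← Complex.ofReal_add]
    congr 3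
    simp [Complex.inner]
  simp_rw [key]
  rw [integral_prod_mul (fun x : ℝ => Complex.exp (((inner ℝ x w.re : ℝ) : ℂ) * Complex.I))
    (fun x : ℝ => Complex.exp (((inner ℝ x w.im : ℝ) : ℂ) * Complex.I)), hre, him,
    ← Complex.exp_add]
  congr 1
  have h := Complex.sq_norm w
  rw [Complex.normSq_apply] at h
  have h' : (‖w‖ : ℂ) ^ 2 = w.re * w.re + w.im * w.im := by exact_mod_cast h
  rw [h']
  push_cast
  ring

/-- A real linear combination of independent circular Gaussian variables is circular Gaussian. -/
theorem map_sum_circularGaussian {Ω ι : Type*} [MeasurableSpace Ω] {P : Measure Ω}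
    [IsProbabilityMeasure P] {X : ι → Ω → ℂ} {v : ι → ℝ≥0} (hX : ∀ i, Measurable (X i))
    (hlaw : ∀ i, P.map (X i) = circularGaussian (v i)) (hind : iIndepFun X P)
    (s : Finset ι) (w : ι → ℝ) :
    P.map (∑ i ∈ s, fun ω => (w i : ℂ) * X i ω)
      = circularGaussian (∑ i ∈ s, (w i ^ 2).toNNReal * v i) := by
  have hm : ∀ i, Measurable (fun ω => (w i : ℂ) * X i ω) := fun i => (hX i).const_mul _
  have hind' : iIndepFun (fun i ω => (w i : ℂ) * X i ω) P :=
    hind.comp (fun i x => (w i : ℂ) * x) (fun i => measurable_const_mul _)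
  have hms : Measurable (∑ i ∈ s, fun ω => (w i : ℂ) * X i ω) := by
    fun_prop
  have := Measure.isProbabilityMeasure_map hms.aemeasurable (μ := P)
  refine Measure.ext_of_charFun ?_
  rw [iIndepFun.charFun_map_finsetSum_eq_prod (fun i _ => (hm i).aemeasurable)
    (hind'.restrict _)]
  ext t
  rw [Finset.prod_apply, charFun_circularGaussian]
  have hterm : ∀ i, charFun (P.map (fun ω => (w i : ℂ) * X i ω)) t
      = Complex.exp (-(((w i ^ 2).toNNReal * v i : ℝ≥0) * ‖t‖ ^ 2 / 4)) := by
    intro i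
    have h1 : P.map (fun ω => (w i : ℂ) * X i ω)
        = (circularGaussian (v i)).map (fun z => w i • z) := by
      rw [← hlaw i, Measure.map_map (by fun_prop) (hX i)]
      rfl
    rw [h1, charFun_map_smul, charFun_circularGaussian, norm_smul]
    congr 1
    rw [NNReal.coe_mul, Real.coe_toNNReal _ (sq_nonneg _), Real.norm_eq_abs, ← Complex.ofReal_pow,
      mul_pow, sq_abs]
    push_cast
    ring
  simp_rw [hterm]
  rw [← Complex.exp_sum]
  congr 1
  push_cast
  rw [Finset.sum_mul, Finset.sum_div, Finset.sum_neg_distrib]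

/-- The density of the circular Gaussian law of variance `v`. -/
def circularPDF (v : ℝ≥0) (z : ℂ) : ℝ := (Real.pi * v)⁻¹ * Real.exp (-(‖z‖ ^ 2 / v))

theorem circularPDF_pos {v : ℝ≥0} (hv : v ≠ 0) (z : ℂ) : 0 < circularPDF v z := by
  have : 0 < (v : ℝ) := by positivity
  unfold circularPDF
  positivity

theorem measurable_circularPDF (v : ℝ≥0) : Measurable (circularPDF v) := by
  unfold circularPDF
  fun_prop

/-- Used twice: for the identification of `ℝ × ℝ` with `ℂ`, and for the shear `(z, b) ↦ (z + b, b)`.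
-/
theorem map_withDensity_of_measurePreserving {α β : Type*} [MeasurableSpace α]
    [MeasurableSpace β] {μ : Measure α} {ν : Measure β} (e : α ≃ᵐ β)
    (he : MeasurePreserving e μ ν) (f : α → ℝ≥0∞) :
    (μ.withDensity f).map e = ν.withDensity (f ∘ e.symm) := by
  ext s hs
  rw [Measure.map_apply e.measurable hs, withDensity_apply _ (e.measurable hs),
    withDensity_apply _ hs, ← he.setLIntegral_comp_preimage_emb e.measurableEmbedding]
  simp

theorem circularGaussian_eq_withDensity {v : ℝ≥0} (hv : v ≠ 0) :
    circularGaussian v = volume.withDensity (fun z => ENNReal.ofReal (circularPDF v z)) := by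
  have hv2 : v / 2 ≠ 0 := by simpa using hv
  have hvr : (v : ℝ) ≠ 0 := by simpa using hv
  rw [circularGaussian, gaussianReal_of_var_ne_zero _ hv2,
    prod_withDensity (measurable_gaussianPDF _ _) (measurable_gaussianPDF _ _),
    ← Measure.volume_eq_prod]
  have h := map_withDensity_of_measurePreserving Complex.measurableEquivRealProd.symm
    (Complex.volume_preserving_equiv_real_prod.symm _)
    (fun z : ℝ × ℝ => gaussianPDF 0 (v / 2) z.1 * gaussianPDF 0 (v / 2) z.2)
  refine h.trans ?_
  congr 1
  ext z
  simp only [Function.comp_apply, MeasurableEquiv.symm_symm, Complex.measurableEquivRealProd_apply,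
    gaussianPDF]
  rw [← ENNReal.ofReal_mul (gaussianPDFReal_nonneg _ _ _)]
  congr 1
  rw [gaussianPDFReal, gaussianPDFReal, circularPDF, mul_mul_mul_comm, ← Real.exp_add,
    ← mul_inv, Real.mul_self_sqrt (by positivity), Complex.sq_norm, Complex.normSq_apply]
  congr 2
  · push_cast; ring
  · push_cast; field_simp; ring

theorem normSq_complexMk (x y : ℝ) : ‖(⟨x, y⟩ : ℂ)‖ ^ 2 = x ^ 2 + y ^ 2 := by
  rw [Complex.sq_norm, Complex.normSq_mk, sq, sq]

theorem integrable_normSq_circularGaussian (v : ℝ≥0) :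
    Integrable (fun z : ℂ => ‖z‖ ^ 2) (circularGaussian v) := by
  rw [circularGaussian, integrable_map_measure (by fun_prop) measurable_complexMk.aemeasurable]
  have h : Integrable (fun x : ℝ => x ^ 2) (gaussianReal 0 (v / 2)) :=
    (memLp_id_gaussianReal 2).integrable_sq
  have h' := (h.comp_fst (gaussianReal 0 (v / 2))).add (h.comp_snd (gaussianReal 0 (v / 2)))
  refine h'.congr (ae_of_all _ fun p => ?_)
  simp only [Function.comp_apply, normSq_complexMk, Pi.add_apply]

theorem integral_normSq_circularGaussian (v : ℝ≥0) :
    ∫ z : ℂ, ‖z‖ ^ 2 ∂(circularGaussian v) = v := by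
  rw [circularGaussian, integral_map measurable_complexMk.aemeasurable (by fun_prop)]
  have h : Integrable (fun x : ℝ => x ^ 2) (gaussianReal 0 (v / 2)) :=
    (memLp_id_gaussianReal 2).integrable_sq
  have hv : ∫ x, x ^ 2 ∂(gaussianReal 0 (v / 2)) = v / 2 := by
    have h1 := variance_fun_id_gaussianReal (μ := 0) (v := v / 2)
    rw [variance_eq_integral (by fun_prop)] at h1
    simpa using h1
  simp_rw [normSq_complexMk]
  rw [integral_add (h.comp_fst _) (h.comp_snd _),
    integral_fun_fst (fun x : ℝ => x ^ 2), integral_fun_snd (fun x : ℝ => x ^ 2), hv]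
  simp

/-! ### Mutual information of the scalar Gaussian channel -/

/-- The shear `(z, b) ↦ (z + b, b)` as a measurable equivalence. -/
def shearAdd : ℂ × ℂ ≃ᵐ ℂ × ℂ where
  toFun p := (p.1 + p.2, p.2)
  invFun p := (p.1 - p.2, p.2)
  left_inv p := by simp
  right_inv p := by simp
  measurable_toFun := by simp only [Equiv.coe_fn_mk]; fun_prop
  measurable_invFun := by simp only [Equiv.coe_fn_symm_mk]; fun_prop

theorem map_add_circularGaussian (s a : ℝ≥0) :
    ((circularGaussian s).prod (circularGaussian a)).map (fun p => p.1 + p.2)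
      = circularGaussian (s + a) := by
  have := Measure.isProbabilityMeasure_map
    (μ := (circularGaussian s).prod (circularGaussian a))
    (measurable_fst.add measurable_snd).aemeasurable
  refine Measure.ext_of_charFun ?_
  rw [charFun_map_add_prod_eq_mul]
  ext t
  rw [Pi.mul_apply, charFun_circularGaussian, charFun_circularGaussian,
    charFun_circularGaussian, ← Complex.exp_add]
  push_cast
  ring_nf

/-- The likelihood ratio of `(y, b)` between the joint law of the output `y = z + b` and the
input `b`, and the product of their laws. -/
def channelRatio (s a : ℝ≥0) (p : ℂ × ℂ) : ℝ :=
  circularPDF s (p.1 - p.2) / circularPDF (s + a) p.1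

theorem measurable_channelRatio (s a : ℝ≥0) : Measurable (channelRatio s a) :=
  ((measurable_circularPDF s).comp (measurable_fst.sub measurable_snd)).div
    ((measurable_circularPDF (s + a)).comp measurable_fst)

theorem channelRatio_pos {s : ℝ≥0} (hs : s ≠ 0) (a : ℝ≥0) (p : ℂ × ℂ) :
    0 < channelRatio s a p :=
  div_pos (circularPDF_pos hs _) (circularPDF_pos (by simp [hs]) _)

/-- The shear preserves Lebesgue measure, so `(z + b, b)` has density `p_s(y - b) p_a(b)` at `(y,
b)`. Dividing by `p_{s+a}(y) p_a(b)` leaves `channelRatio`. -/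
theorem map_shearAdd_circularGaussian {s a : ℝ≥0} (hs : s ≠ 0) (ha : a ≠ 0) :
    ((circularGaussian s).prod (circularGaussian a)).map shearAdd
      = ((circularGaussian (s + a)).prod (circularGaussian a)).withDensity
        (fun p => ENNReal.ofReal (channelRatio s a p)) := by
  have hsa : s + a ≠ 0 := by simp [hs]
  have hm := fun v => (measurable_circularPDF v).ennreal_ofReal
  have hpres : MeasurePreserving shearAdd (volume : Measure (ℂ × ℂ)) volume :=
    measurePreserving_add_prod volume volume
  have hr := (measurable_channelRatio s a).ennreal_ofReal
  rw [circularGaussian_eq_withDensity hs, circularGaussian_eq_withDensity ha,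
    circularGaussian_eq_withDensity hsa, prod_withDensity (hm _) (hm _),
    prod_withDensity (hm _) (hm _), ← Measure.volume_eq_prod,
    map_withDensity_of_measurePreserving shearAdd hpres]
  refine Eq.trans ?_ (withDensity_mul volume
    (((hm (s + a)).comp measurable_fst).mul ((hm a).comp measurable_snd)) hr)
  congr 1
  ext p
  have h1 := circularPDF_pos hsa p.1
  have h2 := circularPDF_pos ha p.2
  simp only [Function.comp_apply, Pi.mul_apply, channelRatio, shearAdd, MeasurableEquiv.symm_mk,
    MeasurableEquiv.coe_mk, Equiv.symm_mk, Equiv.coe_fn_mk]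
  rw [mul_right_comm, ← ENNReal.ofReal_mul h1.le, mul_div_cancel₀ _ h1.ne']

theorem log_channelRatio {s a : ℝ≥0} (hs : s ≠ 0) (p : ℂ × ℂ) :
    Real.log (channelRatio s a p)
      = Real.log (1 + a / s) - ‖p.1 - p.2‖ ^ 2 / s + ‖p.1‖ ^ 2 / (s + a : ℝ≥0) := by
  have hsa : s + a ≠ 0 := by simp [hs]
  have hs' : 0 < (s : ℝ) := by positivity
  have ha' : 0 ≤ (a : ℝ) := a.2
  have hc : (Real.pi * s)⁻¹ / (Real.pi * (s + a : ℝ≥0))⁻¹ = 1 + (a : ℝ) / s := by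
    have := Real.pi_pos
    push_cast
    field_simp
  rw [channelRatio, circularPDF, circularPDF, mul_div_mul_comm, hc, ← Real.exp_sub,
    Real.log_mul (by positivity) (Real.exp_ne_zero _), Real.log_exp]
  ring

/-- If `b` and `z` are independent circular Gaussian variables of variances `a` and `s`, then
`I(z + b ; b) = log (1 + a / s)`. -/
theorem klDiv_map_shearAdd {s a : ℝ≥0} (hs : s ≠ 0) (ha : a ≠ 0) :
    InformationTheory.klDiv (((circularGaussian s).prod (circularGaussian a)).map shearAdd)
      ((circularGaussian (s + a)).prod (circularGaussian a))
      = ENNReal.ofReal (Real.log (1 + a / s)) := by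
  have hsa : s + a ≠ 0 := by simp [hs]
  set ρ := ((circularGaussian s).prod (circularGaussian a)).map shearAdd with hρ
  set ν := (circularGaussian (s + a)).prod (circularGaussian a) with hν
  have hdens : ρ = ν.withDensity (fun p => ENNReal.ofReal (channelRatio s a p)) :=
    map_shearAdd_circularGaussian hs ha
  have : IsProbabilityMeasure ρ :=
    Measure.isProbabilityMeasure_map shearAdd.measurable.aemeasurable
  have hac : ρ ≪ ν := by rw [hdens]; exact withDensity_absolutelyContinuous _ _
  have hr := (measurable_channelRatio s a).ennreal_ofReal
  -- The density is determined only `ν`-almost everywhere; `ρ ≪ ν` carries the identity over to `ρ`.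
  have hllr : llr ρ ν =ᵐ[ρ] fun p =>
      Real.log (1 + a / s) - ‖p.1 - p.2‖ ^ 2 / s + ‖p.1‖ ^ 2 / (s + a : ℝ≥0) := by
    have h := Measure.rnDeriv_withDensity ν hr
    rw [← hdens] at h
    filter_upwards [hac.ae_le h] with p hp
    rw [llr, hp, ENNReal.toReal_ofReal (channelRatio_pos hs a p).le, log_channelRatio hs]
  have hmap1 : ρ.map (fun p => p.1 - p.2) = circularGaussian s := by
    rw [hρ, Measure.map_map (by fun_prop) shearAdd.measurable]
    have : (fun p : ℂ × ℂ => p.1 - p.2) ∘ shearAdd = Prod.fst := by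
      ext p; simp [shearAdd]
    rw [this, ← Measure.fst, Measure.fst_prod]
  have hmap2 : ρ.map Prod.fst = circularGaussian (s + a) := by
    rw [hρ, Measure.map_map (by fun_prop) shearAdd.measurable]
    exact map_add_circularGaussian s a
  have hi1 : Integrable (fun p : ℂ × ℂ => ‖p.1 - p.2‖ ^ 2) ρ := by
    have h := integrable_normSq_circularGaussian s
    rw [← hmap1] at h
    exact h.comp_measurable (by fun_prop)
  have hi2 : Integrable (fun p : ℂ × ℂ => ‖p.1‖ ^ 2) ρ := by
    have h := integrable_normSq_circularGaussian (s + a)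
    rw [← hmap2] at h
    exact h.comp_measurable (by fun_prop)
  have he1 : ∫ p, ‖p.1 - p.2‖ ^ 2 ∂ρ = s := by
    have h := integral_normSq_circularGaussian s
    rwa [← hmap1, integral_map (by fun_prop) (by fun_prop)] at h
  have he2 : ∫ p, ‖p.1‖ ^ 2 ∂ρ = (s + a : ℝ≥0) := by
    have h := integral_normSq_circularGaussian (s + a)
    rwa [← hmap2, integral_map (by fun_prop) (by fun_prop)] at h
  have hi3 : Integrable (fun p : ℂ × ℂ => Real.log (1 + a / s) - ‖p.1 - p.2‖ ^ 2 / s) ρ :=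
    (integrable_const _).sub (hi1.div_const _)
  have hi : Integrable (llr ρ ν) ρ := (hi3.add (hi2.div_const _)).congr hllr.symm
  -- Under `ρ` both normalized quadratic terms have mean one, so they cancel and only the constant
  -- survives.
  rw [InformationTheory.klDiv_of_ac_of_integrable hac hi, integral_congr_ae hllr,
    integral_add hi3 (hi2.div_const _),
    integral_sub (integrable_const _) (hi1.div_const _), integral_div, integral_div, he1, he2,
    div_self (by simpa using hs), div_self (by exact_mod_cast hsa)]
  simp

/-! ### Conditional mutual information given an independent variable -/

/-- If `W` is independent of `Z`, the conditional law of `f (Z, W)` given `Z = z` is the law of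
`f (z, W)`. -/
theorem condDistrib_ae_eq_map_of_indepFun {Ω 𝓦 𝓨 𝓩 : Type*} [MeasurableSpace Ω]
    [MeasurableSpace 𝓦] [MeasurableSpace 𝓨] [StandardBorelSpace 𝓨] [Nonempty 𝓨]
    [MeasurableSpace 𝓩] {P : Measure Ω} [IsProbabilityMeasure P] {Z : Ω → 𝓩} {W : Ω → 𝓦}
    (hZ : Measurable Z) (hW : Measurable W) (hind : IndepFun Z W P)
    {f : 𝓩 × 𝓦 → 𝓨} (hf : Measurable f) :
    ∀ᵐ z ∂(P.map Z), condDistrib (fun ω => f (Z ω, W ω)) Z P z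
      = P.map (fun ω => f (z, W ω)) := by
  have hW' := Measure.isProbabilityMeasure_map hW.aemeasurable (μ := P)
  have hZ' := Measure.isProbabilityMeasure_map hZ.aemeasurable (μ := P)
  let κ : Kernel 𝓩 𝓨 := (Kernel.id ×ₖ Kernel.const 𝓩 (P.map W)).map f
  have hκm : IsMarkovKernel κ := Kernel.IsMarkovKernel.map _ hf
  have hκ : ∀ z, κ z = P.map (fun ω => f (z, W ω)) := by
    intro z
    rw [Kernel.map_apply _ hf, Kernel.prod_apply, Kernel.id_apply, Kernel.const_apply,
      Measure.dirac_prod, Measure.map_map hf (by fun_prop), Measure.map_map (by fun_prop) hW]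
    rfl
  have hZW : P.map (fun ω => (Z ω, W ω)) = (P.map Z).prod (P.map W) :=
    (indepFun_iff_map_prod_eq_prod_map_map hZ.aemeasurable hW.aemeasurable).1 hind
  have hfZW : Measurable (fun ω => f (Z ω, W ω)) := hf.comp (hZ.prodMk hW)
  -- By uniqueness of disintegration it suffices that `κ`, composed with the law of `Z`, reproduces
  -- the joint law; this is Fubini for the product law of `(Z, W)`.
  have h := condDistrib_ae_eq_of_measure_eq_compProd (μ := P) Z hfZW.aemeasurable (κ := κ) (by
    ext s hs
    have hg : Measurable (fun p : 𝓩 × 𝓦 => (p.1, f p)) := measurable_fst.prodMk hf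
    have h1 : P.map (fun ω => (Z ω, f (Z ω, W ω)))
        = ((P.map Z).prod (P.map W)).map (fun p => (p.1, f p)) := by
      rw [← hZW, Measure.map_map hg (hZ.prodMk hW)]
      rfl
    rw [h1, Measure.map_apply hg hs, Measure.prod_apply (hg hs), Measure.compProd_apply hs]
    refine lintegral_congr fun z => ?_
    rw [hκ, Measure.map_apply hW (measurable_prodMk_left (hg hs)),
      Measure.map_apply (f := fun ω => f (z, W ω)) (hf.comp (measurable_const.prodMk hW))
        (measurable_prodMk_left hs)]
    rfl)
  filter_upwards [h] with z hz
  rw [hz, hκ]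

/-- The conditional mutual information given `Z` of two functions of `Z` and an independent `W`
is the average over `Z` of the mutual information with `Z` frozen. -/
theorem condMutualInfo_eq_lintegral_of_indepFun {Ω 𝓦 𝓧 𝓨 𝓩 : Type*} [MeasurableSpace Ω]
    [MeasurableSpace 𝓦] [MeasurableSpace 𝓧] [StandardBorelSpace 𝓧] [Nonempty 𝓧]
    [MeasurableSpace 𝓨] [StandardBorelSpace 𝓨] [Nonempty 𝓨]
    [MeasurableSpace 𝓩] {P : Measure Ω} [IsProbabilityMeasure P] {Z : Ω → 𝓩} {W : Ω → 𝓦}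
    (hZ : Measurable Z) (hW : Measurable W) (hind : IndepFun Z W P)
    {f : 𝓩 × 𝓦 → 𝓧} (hf : Measurable f) {g : 𝓩 × 𝓦 → 𝓨} (hg : Measurable g) :
    condMutualInfo (fun ω => f (Z ω, W ω)) (fun ω => g (Z ω, W ω)) Z P
      = ∫⁻ z, InformationTheory.klDiv (P.map (fun ω => (f (z, W ω), g (z, W ω))))
        ((P.map (fun ω => f (z, W ω))).prod (P.map (fun ω => g (z, W ω)))) ∂(P.map Z) := by
  refine lintegral_congr_ae ?_
  filter_upwards [condDistrib_ae_eq_map_of_indepFun hZ hW hind hf,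
    condDistrib_ae_eq_map_of_indepFun hZ hW hind hg,
    condDistrib_ae_eq_map_of_indepFun hZ hW hind (hf.prodMk hg)] with z h1 h2 h3
  rw [h1, h2, h3]

/-! ### The matched-filter channel for a fixed spreading matrix -/

theorem interferenceEnergy_nonneg {N K : ℕ} (S : Matrix (Fin N) (Fin K) ℝ) (u : Fin K) :
    0 ≤ interferenceEnergy S u :=
  Finset.sum_nonneg fun _ _ => sq_nonneg _

/-- Indexing by `Fin K ⊕ Fin N` merges symbols and noise into one independent family, so that the
output is a single real linear combination. -/
theorem matchedFilter_received {N K : ℕ} (S : Matrix (Fin N) (Fin K) ℝ) (u : Fin K)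
    (b : Fin K → ℂ) (n : Fin N → ℂ) :
    matchedFilter S u (received S b n)
      = ∑ i, ((Sum.elim (crossCorr S u) (fun j => S j u) i : ℝ) : ℂ) * Sum.elim b n i := by
  rw [Fintype.sum_sum_type]
  simp only [matchedFilter, received, dotProduct_add, Sum.elim_inl, Sum.elim_inr]
  congr 1
  rw [Matrix.dotProduct_mulVec]
  simp only [dotProduct, Matrix.vecMul, crossCorr, Matrix.map_apply]
  push_cast
  rfl

theorem iIndepFun_sumElim {Ω ι ι' : Type*} [Fintype ι] [Fintype ι'] [MeasurableSpace Ω]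
    {P : Measure Ω} [IsProbabilityMeasure P] {b : Ω → ι → ℂ} {n : Ω → ι' → ℂ}
    {μ : ι → Measure ℂ} {ν : ι' → Measure ℂ} [∀ i, IsProbabilityMeasure (μ i)]
    [∀ i, IsProbabilityMeasure (ν i)] (hb : Measurable b) (hn : Measurable n)
    (hbl : P.map b = Measure.pi μ) (hnl : P.map n = Measure.pi ν) (hind : IndepFun b n P) :
    iIndepFun (fun (i : ι ⊕ ι') ω => Sum.elim (b ω) (n ω) i) P ∧
      ∀ i : ι ⊕ ι', P.map (fun ω => Sum.elim (b ω) (n ω) i) = Sum.elim μ ν i := by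
  have hX : ∀ i : ι ⊕ ι', Measurable (fun ω => Sum.elim (b ω) (n ω) i) := by
    rintro (i | i)
    · exact (measurable_pi_apply i).comp hb
    · exact (measurable_pi_apply i).comp hn
  have hlaw : ∀ i : ι ⊕ ι', P.map (fun ω => Sum.elim (b ω) (n ω) i) = Sum.elim μ ν i := by
    rintro (i | i)
    · have h := (measurePreserving_eval μ i).map_eq
      rw [← hbl, Measure.map_map (measurable_pi_apply i) hb] at h
      exact h
    · have h := (measurePreserving_eval ν i).map_eq
      rw [← hnl, Measure.map_map (measurable_pi_apply i) hn] at h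
      exact h
  refine ⟨?_, hlaw⟩
  rw [iIndepFun_iff_map_fun_eq_pi_map (fun i => (hX i).aemeasurable)]
  simp_rw [hlaw]
  have hprod : P.map (fun ω => (b ω, n ω)) = (Measure.pi μ).prod (Measure.pi ν) := by
    rw [← hbl, ← hnl]
    exact (indepFun_iff_map_prod_eq_prod_map_map hb.aemeasurable hn.aemeasurable).1 hind
  have hs : ∀ i : ι ⊕ ι', IsProbabilityMeasure (Sum.elim μ ν i) := by
    rintro (i | i) <;> simp only [Sum.elim_inl, Sum.elim_inr] <;> infer_instance
  have h := (measurePreserving_sumPiEquivProdPi_symm (X := fun _ : ι ⊕ ι' => ℂ)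
    (Sum.elim μ ν)).map_eq
  simp only [Sum.elim_inl, Sum.elim_inr] at h
  rw [← hprod, Measure.map_map (MeasurableEquiv.measurable _) (hb.prodMk hn)] at h
  rw [← h]
  congr 1

/-- For a fixed matrix with `‖s_u‖ = 1`, the matched filter of user `u` turns the channel into a
scalar Gaussian channel whose noise is the sum of the background noise and the interference. -/
theorem klDiv_matchedFilter {Ω : Type*} [MeasurableSpace Ω] {P : Measure Ω}
    [IsProbabilityMeasure P] {N K : ℕ} {E N₀ : ℝ≥0} (hE : E ≠ 0) (hN₀ : N₀ ≠ 0)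
    {b : Ω → Fin K → ℂ} {n : Ω → Fin N → ℂ} (hb : Measurable b) (hn : Measurable n)
    (hbl : P.map b = Measure.pi fun _ => circularGaussian E)
    (hnl : P.map n = Measure.pi fun _ => circularGaussian N₀) (hind : IndepFun b n P)
    (S : Matrix (Fin N) (Fin K) ℝ) (u : Fin K) (hS : crossCorr S u u = 1) :
    InformationTheory.klDiv
      (P.map (fun ω => (matchedFilter S u (received S (b ω) (n ω)), b ω u)))
      ((P.map (fun ω => matchedFilter S u (received S (b ω) (n ω)))).prod
        (P.map (fun ω => b ω u)))
      = ENNReal.ofReal (Real.log (1 + E / (interferenceEnergy S u * E + N₀))) := by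
  obtain ⟨hiind, hlaw⟩ := iIndepFun_sumElim hb hn hbl hnl hind
  set X : Fin K ⊕ Fin N → Ω → ℂ := fun i ω => Sum.elim (b ω) (n ω) i with hXdef
  set w : Fin K ⊕ Fin N → ℝ := Sum.elim (crossCorr S u) (fun j => S j u) with hw
  set v : Fin K ⊕ Fin N → ℝ≥0 := Sum.elim (fun _ => E) (fun _ => N₀) with hv
  have hX : ∀ i, Measurable (X i) := by
    rintro (i | i)
    · exact (measurable_pi_apply i).comp hb
    · exact (measurable_pi_apply i).comp hn
  have hlaw' : ∀ i, P.map (X i) = circularGaussian (v i) := by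
    intro i
    rw [hlaw i]
    cases i <;> rfl
  have hwu : w (Sum.inl u) = 1 := hS
  -- `Z` is the output without the term of `b_u`, whose weight is one.
  set Z : Ω → ℂ := ∑ i ∈ Finset.univ.erase (Sum.inl u), fun ω => (w i : ℂ) * X i ω with hZ
  have hZm : Measurable Z := by
    have := fun i => (hX i).const_mul (w i : ℂ)
    rw [hZ]
    fun_prop
  -- The erased term is restored on both sides and cancelled. The noise weights `S j u ^ 2` sum to
  -- `crossCorr S u u = 1`, so the filter leaves the noise variance at `N₀`.
  have hvar : (∑ i ∈ Finset.univ.erase (Sum.inl u), (w i ^ 2).toNNReal * v i)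
      = (interferenceEnergy S u).toNNReal * E + N₀ := by
    have hadd := Finset.add_sum_erase Finset.univ (fun i => (w i ^ 2).toNNReal * v i)
      (Finset.mem_univ (Sum.inl u))
    have hadd' := Finset.add_sum_erase Finset.univ (fun k => (crossCorr S u k ^ 2).toNNReal * E)
      (Finset.mem_univ u)
    have hnoise : ∑ j, (S j u ^ 2).toNNReal * N₀ = N₀ := by
      rw [← Finset.sum_mul, ← Real.toNNReal_sum_of_nonneg (fun _ _ => sq_nonneg _)]
      have : ∑ j, S j u ^ 2 = 1 := by
        rw [← hS, crossCorr, dotProduct]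
        exact Finset.sum_congr rfl fun _ _ => sq _
      rw [this, Real.toNNReal_one, one_mul]
    have hint : ∑ k ∈ Finset.univ.erase u, (crossCorr S u k ^ 2).toNNReal * E
        = (interferenceEnergy S u).toNNReal * E := by
      rw [← Finset.sum_mul, ← Real.toNNReal_sum_of_nonneg (fun _ _ => sq_nonneg _)]
      rfl
    rw [Fintype.sum_sum_type] at hadd
    simp only [hw, hv, Sum.elim_inl, Sum.elim_inr] at hadd ⊢
    rw [hnoise, ← hadd', hint, add_assoc] at hadd
    exact add_left_cancel hadd
  set s : ℝ≥0 := (interferenceEnergy S u).toNNReal * E + N₀ with hs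
  have hs0 : s ≠ 0 := by simp [hs, hN₀]
  have hZlaw : P.map Z = circularGaussian s := by
    rw [hZ, map_sum_circularGaussian hX hlaw' hiind, hvar]
  have hbu : Measurable (fun ω => b ω u) := hX (Sum.inl u)
  have hbulaw : P.map (fun ω => b ω u) = circularGaussian E := hlaw' (Sum.inl u)
  have hZb : IndepFun Z (fun ω => b ω u) P := by
    have h := (hiind.comp (fun i x => (w i : ℂ) * x)
      (fun i => measurable_const_mul _)).indepFun_finsetSum_of_notMem
      (fun i => (hX i).const_mul _) (Finset.notMem_erase (Sum.inl u) Finset.univ)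
    have e : (fun x => (w (Sum.inl u) : ℂ) * x) ∘ X (Sum.inl u) = fun ω => b ω u := by
      ext ω
      simp [hwu, hXdef]
    rw [e] at h
    exact h
  have hy : ∀ ω, matchedFilter S u (received S (b ω) (n ω)) = Z ω + b ω u := by
    intro ω
    rw [matchedFilter_received, ← Finset.add_sum_erase Finset.univ _ (Finset.mem_univ (Sum.inl u)),
      hZ, Finset.sum_apply, add_comm]
    congr 1
    change ((crossCorr S u u : ℝ) : ℂ) * b ω u = _
    rw [hS, Complex.ofReal_one, one_mul]
  have hpair : P.map (fun ω => (Z ω, b ω u))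
      = (circularGaussian s).prod (circularGaussian E) := by
    rw [← hZlaw, ← hbulaw]
    exact (indepFun_iff_map_prod_eq_prod_map_map hZm.aemeasurable hbu.aemeasurable).1 hZb
  have hjoint : P.map (fun ω => (Z ω + b ω u, b ω u))
      = ((circularGaussian s).prod (circularGaussian E)).map shearAdd := by
    rw [← hpair, Measure.map_map shearAdd.measurable (hZm.prodMk hbu)]
    rfl
  have hylaw : P.map (fun ω => Z ω + b ω u) = circularGaussian (s + E) := by
    rw [← map_add_circularGaussian, ← hpair, Measure.map_map (by fun_prop) (hZm.prodMk hbu)]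
    rfl
  simp_rw [hy]
  rw [hjoint, hylaw, hbulaw, klDiv_map_shearAdd hs0 hE]
  simp [hs, Real.coe_toNNReal _ (interferenceEnergy_nonneg S u)]

/-! ### Cross-correlations of time-hopping sequences -/

/-- The indicator that two pulses of a subgroup have the same position. -/
def pulseMatch {Nh : ℕ} (p q : Fin Nh × Bool) : ℝ := if p.1 = q.1 then 1 else 0

/-- The sign of a pulse. -/
def pulseSign (s : Bool) : ℝ := if s then 1 else -1

theorem pulseSign_sq (s : Bool) : pulseSign s ^ 2 = 1 := by
  cases s <;> simp [pulseSign]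

/-- Within a subgroup only the chip of the pulse of `d` can contribute, and it does so exactly when
the pulse of `x` sits there too. -/
theorem thSequence_dotProduct {Ns Nh : ℕ} (d x : Fin Ns → Fin Nh × Bool) :
    thSequence d ⬝ᵥ thSequence x
      = (∑ m, pulseMatch (d m) (x m) * (pulseSign (d m).2 * pulseSign (x m).2)) / Ns := by
  rw [dotProduct, ← finProdFinEquiv.sum_comp, Fintype.sum_prod_type, Finset.sum_div]
  refine Finset.sum_congr rfl fun m _ => ?_
  simp only [thSequence, Equiv.symm_apply_apply]
  rw [Finset.sum_eq_single (d m).1]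
  · rw [if_pos rfl]
    have hsq : √(Ns : ℝ) * √(Ns : ℝ) = Ns := Real.mul_self_sqrt (Nat.cast_nonneg _)
    by_cases h : (d m).1 = (x m).1
    · rw [if_pos h.symm, pulseMatch, if_pos h, one_mul, div_mul_div_comm, hsq]
      rfl
    · rw [if_neg (Ne.symm h), pulseMatch, if_neg h]
      simp
  · intro h _ hne
    rw [if_neg (Ne.symm hne), zero_mul]
  · simp

theorem crossCorr_thMatrix {Ns Nh K : ℕ} (c : Fin K → Fin Ns → Fin Nh × Bool) (u k : Fin K) :
    crossCorr (thMatrix c) u k = thSequence (c u) ⬝ᵥ thSequence (c k) := rfl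

theorem crossCorr_thMatrix_self {Ns Nh K : ℕ} (hNs : 0 < Ns)
    (c : Fin K → Fin Ns → Fin Nh × Bool) (u : Fin K) :
    crossCorr (thMatrix c) u u = 1 := by
  have : (Ns : ℝ) ≠ 0 := by positivity
  rw [crossCorr_thMatrix, thSequence_dotProduct]
  simp [pulseMatch, ← sq, pulseSign_sq, this]

/-- The characteristic exponential of a squared cross-correlation, to first order in the number
of matching pulses. -/
theorem norm_exp_dotProduct_sq_sub_le {Ns Nh : ℕ} (d x : Fin Ns → Fin Nh × Bool) (t : ℝ) :
    ‖Complex.exp (((thSequence d ⬝ᵥ thSequence x) ^ 2 * t : ℝ) * Complex.I) - 1 -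
        ∑ m, (pulseMatch (d m) (x m) : ℂ) * (Complex.exp ((t / Ns ^ 2 : ℝ) * Complex.I) - 1)‖
      ≤ (2 + 2 * Ns) * ∑ m, ∑ m' ∈ Finset.univ.erase m,
        pulseMatch (d m) (x m) * pulseMatch (d m') (x m') := by
  have h01 : ∀ m, 0 ≤ pulseMatch (d m) (x m) := fun m => by
    unfold pulseMatch; split_ifs <;> norm_num
  have hle : ∀ m, pulseMatch (d m) (x m) ≤ 1 := fun m => by
    unfold pulseMatch; split_ifs <;> norm_num
  have hnn : 0 ≤ ∑ m, ∑ m' ∈ Finset.univ.erase m,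
      pulseMatch (d m) (x m) * pulseMatch (d m') (x m') :=
    Finset.sum_nonneg fun m _ => Finset.sum_nonneg fun m' _ => mul_nonneg (h01 m) (h01 m')
  -- With two matches the sum over ordered pairs is at least one, and the crude bound `|e^{ir} - 1|
  -- ≤ 2` yields the constant `2 + 2 * Ns`. With at most one match the expansion is exact, since
  -- squaring removes the signs.
  by_cases h : ∃ m m', m ≠ m' ∧ (d m).1 = (x m).1 ∧ (d m').1 = (x m').1
  · obtain ⟨m, m', hne, hm, hm'⟩ := h
    have hge : 1 ≤ ∑ m, ∑ m' ∈ Finset.univ.erase m,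
        pulseMatch (d m) (x m) * pulseMatch (d m') (x m') := by
      have e1 : (1 : ℝ) = pulseMatch (d m) (x m) * pulseMatch (d m') (x m') := by
        simp [pulseMatch, hm, hm']
      rw [e1]
      refine (Finset.single_le_sum (f := fun m' =>
        pulseMatch (d m) (x m) * pulseMatch (d m') (x m'))
        (fun m' _ => mul_nonneg (h01 m) (h01 m'))
        (Finset.mem_erase.2 ⟨hne.symm, Finset.mem_univ m'⟩)).trans ?_
      exact Finset.single_le_sum (f := fun m => ∑ m' ∈ Finset.univ.erase m,
        pulseMatch (d m) (x m) * pulseMatch (d m') (x m'))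
        (fun m _ => Finset.sum_nonneg fun m' _ => mul_nonneg (h01 m) (h01 m'))
        (Finset.mem_univ m)
    have hb : ∀ r : ℝ, ‖Complex.exp (r * Complex.I) - 1‖ ≤ 2 := fun r => by
      refine (norm_sub_le _ _).trans ?_
      rw [Complex.norm_exp_ofReal_mul_I, norm_one]
      norm_num
    calc _ ≤ 2 + ∑ _m : Fin Ns, (2 : ℝ) := by
          refine (norm_sub_le _ _).trans (add_le_add (hb _) ?_)
          refine norm_sum_le_of_le _ fun m _ => ?_
          rw [norm_mul, Complex.norm_real, Real.norm_of_nonneg (h01 m)]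
          exact (mul_le_mul (hle m) (hb _) (norm_nonneg _) zero_le_one).trans_eq (one_mul _)
      _ = (2 + 2 * Ns) * 1 := by simp; ring
      _ ≤ _ := mul_le_mul_of_nonneg_left hge (by positivity)
  · push Not at h
    refine le_trans (le_of_eq ?_) (mul_nonneg (by positivity) hnn)
    rw [norm_eq_zero, thSequence_dotProduct]
    by_cases h1 : ∃ m, (d m).1 = (x m).1
    · obtain ⟨m, hm⟩ := h1
      have h0 : ∀ m', m' ≠ m → pulseMatch (d m') (x m') = 0 := fun m' hne =>
        if_neg (h m m' hne.symm hm)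
      have hone : pulseMatch (d m) (x m) = 1 := if_pos hm
      rw [Fintype.sum_eq_single m (fun m' hne => by rw [h0 m' hne, zero_mul]),
        Fintype.sum_eq_single m (fun m' hne => by rw [h0 m' hne, Complex.ofReal_zero, zero_mul]),
        hone, div_pow, one_mul, mul_pow, pulseSign_sq, pulseSign_sq, Complex.ofReal_one, one_mul,
        one_mul, one_div_mul_eq_div, sub_self]
    · push Not at h1
      have h0 : ∀ m, pulseMatch (d m) (x m) = 0 := fun m => if_neg (h1 m)
      simp [h0]

/-! ### Probabilities of matching pulses -/

theorem integral_pulseMatch {Nh : ℕ} [NeZero Nh] (p : Fin Nh × Bool) :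
    ∫ q, pulseMatch p q ∂(uniformOn (Set.univ : Set (Fin Nh × Bool))) = (Nh : ℝ)⁻¹ := by
  have h : (fun q : Fin Nh × Bool => pulseMatch p q)
      = Set.indicator ({p.1} ×ˢ Set.univ) 1 := by
    ext q
    simp [pulseMatch, Set.indicator_apply, eq_comm (a := p.1)]
  rw [h, integral_indicator_one (Set.toFinite _).measurableSet, measureReal_def, uniformOn_univ,
    Measure.count_apply_finite _ (Set.toFinite _)]
  -- The position is prescribed and the sign is free: two outcomes out of `2 * Nh`.
  have hc : (Set.toFinite (({p.1} : Set (Fin Nh)) ×ˢ (Set.univ : Set Bool))).toFinset.card = 2 := by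
    rw [← Set.ncard_eq_toFinset_card, Set.ncard_prod]
    simp
  have hN : (Nh : ℝ) ≠ 0 := NeZero.ne _
  rw [hc]
  simp
  field_simp

/-- The law of the pulses of one user. -/
def codeLaw (Ns Nh : ℕ) : Measure (Fin Ns → Fin Nh × Bool) :=
  Measure.pi fun _ => uniformOn (Set.univ : Set (Fin Nh × Bool))

instance isProbabilityMeasure_codeLaw (Ns Nh : ℕ) [NeZero Nh] :
    IsProbabilityMeasure (codeLaw Ns Nh) := by
  unfold codeLaw
  infer_instance

theorem integral_prod_pulseMatch {Ns Nh : ℕ} [NeZero Nh] (d : Fin Ns → Fin Nh × Bool)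
    (A : Finset (Fin Ns)) :
    ∫ x, ∏ m ∈ A, pulseMatch (d m) (x m) ∂(codeLaw Ns Nh) = ((Nh : ℝ)⁻¹) ^ A.card := by
  -- Padding with factors one outside `A` gives a product over all subgroups, to which independence
  -- applies.
  have h : ∀ x : Fin Ns → Fin Nh × Bool, ∏ m ∈ A, pulseMatch (d m) (x m)
      = ∏ m, (fun q => if m ∈ A then pulseMatch (d m) q else 1) (x m) := fun x => by
    simp
  simp_rw [h]
  rw [codeLaw, integral_fintype_prod_eq_prod
    (fun m q => if m ∈ A then pulseMatch (d m) q else 1)]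
  have h2 : ∀ m, ∫ q, (if m ∈ A then pulseMatch (d m) q else 1)
      ∂(uniformOn (Set.univ : Set (Fin Nh × Bool))) = if m ∈ A then (Nh : ℝ)⁻¹ else 1 := by
    intro m
    split_ifs
    · exact integral_pulseMatch _
    · simp
  simp_rw [h2]
  simp

/-- The characteristic function at `t` of the squared cross-correlation of a fixed sequence with
a random one. -/
def corrCharFun {Ns Nh : ℕ} (t : ℝ) (d : Fin Ns → Fin Nh × Bool) : ℂ :=
  ∫ x, Complex.exp (((thSequence d ⬝ᵥ thSequence x) ^ 2 * t : ℝ) * Complex.I) ∂(codeLaw Ns Nh)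

/-- This averages the pointwise expansion: a match has probability `1 / Nh`, and each of the at most
`Ns ^ 2` ordered pairs of distinct subgroups matches with probability `1 / Nh ^ 2`. The bound does
not depend on `d`. -/
theorem norm_corrCharFun_sub_le {Ns Nh : ℕ} [NeZero Nh] (t : ℝ) (d : Fin Ns → Fin Nh × Bool) :
    ‖corrCharFun t d - 1 -
        Ns * ((Nh : ℂ)⁻¹ * (Complex.exp ((t / Ns ^ 2 : ℝ) * Complex.I) - 1))‖
      ≤ (2 + 2 * Ns) * Ns ^ 2 * ((Nh : ℝ)⁻¹) ^ 2 := by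
  set θ : ℂ := Complex.exp ((t / Ns ^ 2 : ℝ) * Complex.I) - 1 with hθ
  have h1 : ∀ m, ∫ x, pulseMatch (d m) (x m) ∂(codeLaw Ns Nh) = (Nh : ℝ)⁻¹ := fun m => by
    simpa using integral_prod_pulseMatch d {m}
  have h2 : ∀ m, ∀ m' ∈ Finset.univ.erase m, ∫ x, pulseMatch (d m) (x m) * pulseMatch (d m') (x m')
      ∂(codeLaw Ns Nh) = ((Nh : ℝ)⁻¹) ^ 2 := fun m m' hm' => by
    have hne : m ≠ m' := (Finset.ne_of_mem_erase hm').symm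
    have := integral_prod_pulseMatch d {m, m'}
    rw [Finset.card_pair hne] at this
    rw [← this]
    simp_rw [Finset.prod_pair hne]
  have hI : ∫ x, (Complex.exp (((thSequence d ⬝ᵥ thSequence x) ^ 2 * t : ℝ) * Complex.I) - 1 -
      ∑ m, (pulseMatch (d m) (x m) : ℂ) * θ) ∂(codeLaw Ns Nh)
      = corrCharFun t d - 1 - Ns * ((Nh : ℂ)⁻¹ * θ) := by
    rw [integral_sub .of_finite .of_finite, integral_sub .of_finite .of_finite,
      integral_finsetSum _ fun _ _ => .of_finite]
    congr 1
    · simp [corrCharFun]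
    · have : ∀ m, ∫ x, (pulseMatch (d m) (x m) : ℂ) * θ ∂(codeLaw Ns Nh) = (Nh : ℂ)⁻¹ * θ := by
        intro m
        rw [integral_mul_const, integral_complex_ofReal, h1 m]
        push_cast
        rfl
      simp_rw [this]
      simp
  rw [← hI]
  refine (norm_integral_le_of_norm_le .of_finite (ae_of_all _ fun x =>
    norm_exp_dotProduct_sq_sub_le d x t)).trans ?_
  rw [integral_const_mul, integral_finsetSum _ fun _ _ => .of_finite, mul_assoc]
  refine mul_le_mul_of_nonneg_left ?_ (by positivity)
  calc _ ≤ ∑ _m : Fin Ns, ∑ _m' : Fin Ns, ((Nh : ℝ)⁻¹) ^ 2 := by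
        refine Finset.sum_le_sum fun m _ => ?_
        rw [integral_finsetSum _ fun _ _ => .of_finite, Finset.sum_congr rfl (h2 m)]
        exact Finset.sum_le_sum_of_subset_of_nonneg (Finset.erase_subset _ _)
          fun _ _ _ => by positivity
    _ = _ := by simp; ring

/-! ### The Poisson limit of the interference energy -/

/-- Here `m log (1 + g) = m g + O(|m g| |g|)`, and the error vanishes because `m g` converges and `g
→ 0`. The exponents `m` need not tend to infinity. -/
theorem tendsto_one_add_pow_exp {ι : Type*} {l : Filter ι} {g : ι → ℂ} {m : ι → ℕ} {z : ℂ}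
    (hg : Tendsto g l (𝓝 0)) (hmg : Tendsto (fun j => (m j : ℂ) * g j) l (𝓝 z)) :
    Tendsto (fun j => (1 + g j) ^ m j) l (𝓝 (Complex.exp z)) := by
  have hsmall : ∀ᶠ j in l, ‖g j‖ ≤ 1 / 2 := by
    have h := hg.norm
    rw [norm_zero] at h
    exact h.eventually_le_const (by norm_num)
  have hrem : Tendsto (fun j => (m j : ℂ) * (Complex.log (1 + g j) - g j)) l (𝓝 0) := by
    have hb : Tendsto (fun j => ‖(m j : ℂ) * g j‖ * ‖g j‖) l (𝓝 0) := by
      simpa using hmg.norm.mul hg.norm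
    refine squeeze_zero_norm' ?_ hb
    filter_upwards [hsmall] with j hj
    rw [norm_mul, norm_mul, mul_assoc]
    refine mul_le_mul_of_nonneg_left ?_ (norm_nonneg _)
    refine (Complex.norm_log_one_add_sub_self_le (hj.trans_lt (by norm_num))).trans ?_
    have h2 : (1 - ‖g j‖)⁻¹ ≤ 2 := by
      rw [inv_le_comm₀ (by linarith) (by norm_num)]
      linarith
    nlinarith [sq_nonneg ‖g j‖]
  have hlog : Tendsto (fun j => (m j : ℂ) * Complex.log (1 + g j)) l (𝓝 z) := by
    have h := hmg.add hrem
    rw [add_zero] at h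
    exact h.congr fun j => by ring
  refine ((Complex.continuous_exp.tendsto z).comp hlog).congr' ?_
  filter_upwards [hsmall] with j hj
  have hne : 1 + g j ≠ 0 := fun h0 => by
    have : g j = -1 := by linear_combination h0
    rw [this, norm_neg, norm_one] at hj
    norm_num at hj
  rw [Function.comp_apply, Complex.exp_nat_mul, Complex.exp_log hne]

theorem measurable_entry {m n : Type*} (i : m) (k : n) :
    Measurable (fun S : Matrix m n ℝ => S i k) :=
  (measurable_pi_apply k).comp (measurable_pi_apply i)

theorem measurable_crossCorr {N K : ℕ} (u k : Fin K) :
    Measurable (fun S : Matrix (Fin N) (Fin K) ℝ => crossCorr S u k) := by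
  unfold crossCorr dotProduct
  exact Finset.measurable_sum _ fun i _ => (measurable_entry i u).mul (measurable_entry i k)

theorem measurable_interferenceEnergy {N K : ℕ} (u : Fin K) :
    Measurable (fun S : Matrix (Fin N) (Fin K) ℝ => interferenceEnergy S u) :=
  Finset.measurable_sum _ fun k _ => (measurable_crossCorr u k).pow_const 2

theorem thMatrixLaw_eq (Ns Nh K : ℕ) :
    thMatrixLaw Ns Nh K = (Measure.pi fun _ : Fin K => codeLaw Ns Nh).map thMatrix := rfl

/-- Conditioning on the sequence of user `u` makes the cross-correlations i.i.d. -/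
theorem integral_exp_interferenceEnergy {Ns Nh K : ℕ} [NeZero Nh] (u : Fin K) (t : ℝ) :
    ∫ S, Complex.exp ((interferenceEnergy S u * t : ℝ) * Complex.I) ∂(thMatrixLaw Ns Nh K)
      = ∑ d, (codeLaw Ns Nh).real {d} • corrCharFun t d ^ (K - 1) := by
  have hm : Measurable (fun S : Matrix (Fin (Ns * Nh)) (Fin K) ℝ =>
      Complex.exp ((interferenceEnergy S u * t : ℝ) * Complex.I)) := by
    have := measurable_interferenceEnergy (N := Ns * Nh) u
    fun_prop
  rw [thMatrixLaw_eq, integral_map Measurable.of_discrete.aemeasurable hm.aestronglyMeasurable]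
  -- Slot `u` carries the indicator of `c u = d`. Summing over `d` turns the integrand into products
  -- over users, which integrate factor by factor.
  let G : (Fin Ns → Fin Nh × Bool) → Fin K → (Fin Ns → Fin Nh × Bool) → ℂ := fun d k x =>
    if k = u then (if x = d then 1 else 0)
    else Complex.exp (((thSequence d ⬝ᵥ thSequence x) ^ 2 * t : ℝ) * Complex.I)
  have hG : ∀ c : Fin K → Fin Ns → Fin Nh × Bool,
      Complex.exp ((interferenceEnergy (thMatrix c) u * t : ℝ) * Complex.I)
        = ∑ d, ∏ k, G d k (c k) := by
    intro c
    have hsplit : ∀ d, ∏ k, G d k (c k) = (if c u = d then 1 else 0) *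
        ∏ k ∈ Finset.univ.erase u,
          Complex.exp (((thSequence d ⬝ᵥ thSequence (c k)) ^ 2 * t : ℝ) * Complex.I) := by
      intro d
      rw [← Finset.mul_prod_erase _ _ (Finset.mem_univ u)]
      congr 1
      · simp [G]
      · exact Finset.prod_congr rfl fun k hk => if_neg (Finset.ne_of_mem_erase hk)
    simp_rw [hsplit]
    simp only [ite_mul, one_mul, zero_mul, Finset.sum_ite_eq, Finset.mem_univ, if_true]
    rw [← Complex.exp_sum, ← Finset.sum_mul, interferenceEnergy, Finset.sum_mul]
    push_cast
    rfl
  simp_rw [hG]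
  rw [integral_finsetSum _ fun _ _ => .of_finite]
  refine Finset.sum_congr rfl fun d _ => ?_
  rw [integral_fintype_prod_eq_prod (G d), ← Finset.mul_prod_erase _ _ (Finset.mem_univ u)]
  have hu : ∫ x, G d u x ∂(codeLaw Ns Nh) = (codeLaw Ns Nh).real {d} := by
    have : (fun x => G d u x) = Set.indicator {d} (fun _ => (1 : ℂ)) := by
      ext x
      simp [G, Set.indicator_apply]
    rw [this, integral_indicator (measurableSet_singleton d)]
    simp [measureReal_def]
  have hk : ∀ k ∈ Finset.univ.erase u, ∫ x, G d k x ∂(codeLaw Ns Nh) = corrCharFun t d := by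
    intro k hk
    have hne := Finset.ne_of_mem_erase hk
    simp only [G, if_neg hne]
    rfl
  rw [hu, Finset.prod_congr rfl hk, Finset.prod_const, Finset.card_erase_of_mem (Finset.mem_univ u),
    Finset.card_univ, Fintype.card_fin, Complex.real_smul]

/-- The expectation is a convex combination over `d`, so it lies in any ball around `z` that
contains all the values; some worst `d` attains the radius. -/
theorem exists_norm_integral_exp_interferenceEnergy_sub_le {Ns Nh K : ℕ} [NeZero Nh] (u : Fin K)
    (t : ℝ) (z : ℂ) : ∃ d : Fin Ns → Fin Nh × Bool,
    ‖∫ S, Complex.exp ((interferenceEnergy S u * t : ℝ) * Complex.I) ∂(thMatrixLaw Ns Nh K) - z‖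
      ≤ ‖corrCharFun t d ^ (K - 1) - z‖ := by
  obtain ⟨d, -, hd⟩ := Finset.exists_max_image (Finset.univ : Finset (Fin Ns → Fin Nh × Bool))
    (fun d => ‖corrCharFun t d ^ (K - 1) - z‖) Finset.univ_nonempty
  refine ⟨d, ?_⟩
  rw [integral_exp_interferenceEnergy, ← mem_closedBall_iff_norm]
  refine (convex_closedBall z _).sum_mem (fun _ _ => measureReal_nonneg) ?_
    fun d' hd' => mem_closedBall_iff_norm.2 (hd d' hd')
  rw [sum_measureReal_singleton]
  simp

/-- The sequences `d j` are arbitrary, so that the worst case for each system may be inserted. -/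
theorem tendsto_corrCharFun_pow {Ns : ℕ} (hNs : 0 < Ns) {β : ℝ} {Nh K : ℕ → ℕ}
    [∀ j, NeZero (Nh j)] (hNh : Tendsto Nh atTop atTop)
    (hload : Tendsto (fun j => (K j : ℝ) / ((Ns * Nh j : ℕ) : ℝ)) atTop (𝓝 β))
    (hK : ∀ j, 0 < K j) (t : ℝ) (d : ∀ j, Fin Ns → Fin (Nh j) × Bool) :
    Tendsto (fun j => corrCharFun t (d j) ^ (K j - 1)) atTop
      (𝓝 (Complex.exp ((Ns ^ 2 * β : ℝ) *
        (Complex.exp ((t / Ns ^ 2 : ℝ) * Complex.I) - 1)))) := by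
  set θ : ℂ := Complex.exp ((t / Ns ^ 2 : ℝ) * Complex.I) - 1 with hθ
  have hNs' : (Ns : ℝ) ≠ 0 := by positivity
  have hinv : Tendsto (fun j => ((Nh j : ℝ))⁻¹) atTop (𝓝 0) :=
    tendsto_inv_atTop_zero.comp (tendsto_natCast_atTop_atTop.comp hNh)
  -- Replacing `K` by `K - 1` costs only `1 / Nh → 0`; `hK` makes the natural subtraction genuine.
  have hratio : Tendsto (fun j => ((K j - 1 : ℕ) : ℝ) * (Nh j : ℝ)⁻¹) atTop (𝓝 (Ns * β)) := by
    have h := (hload.const_mul (Ns : ℝ)).sub hinv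
    rw [sub_zero] at h
    refine h.congr fun j => ?_
    have hn : (Nh j : ℝ) ≠ 0 := NeZero.ne _
    rw [Nat.cast_sub (hK j)]
    push_cast
    field_simp
  have hinvC : Tendsto (fun j => ((Nh j : ℂ))⁻¹) atTop (𝓝 0) := by
    have h := (Complex.continuous_ofReal.tendsto 0).comp hinv
    simpa [Function.comp_def] using h
  have hratioC : Tendsto (fun j => ((K j - 1 : ℕ) : ℂ) * (Nh j : ℂ)⁻¹) atTop
      (𝓝 ((Ns : ℂ) * β)) := by
    have h := (Complex.continuous_ofReal.tendsto _).comp hratio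
    simpa [Function.comp_def] using h
  set r : ℕ → ℂ := fun j => corrCharFun t (d j) - 1 - Ns * ((Nh j : ℂ)⁻¹ * θ) with hr
  have hrle : ∀ j, ‖r j‖ ≤ (2 + 2 * Ns) * Ns ^ 2 * ((Nh j : ℝ)⁻¹) ^ 2 := fun j =>
    norm_corrCharFun_sub_le t (d j)
  have hr0 : Tendsto r atTop (𝓝 0) := by
    refine squeeze_zero_norm hrle ?_
    simpa using (hinv.pow 2).const_mul ((2 + 2 * (Ns : ℝ)) * Ns ^ 2)
  -- `(K - 1) Nh⁻²` is the convergent ratio `(K - 1) / Nh` times `1 / Nh`, hence vanishes.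
  have hKr : Tendsto (fun j => ((K j - 1 : ℕ) : ℂ) * r j) atTop (𝓝 0) := by
    have hb : Tendsto (fun j => (2 + 2 * (Ns : ℝ)) * Ns ^ 2 *
        ((((K j - 1 : ℕ) : ℝ) * (Nh j : ℝ)⁻¹) * (Nh j : ℝ)⁻¹)) atTop (𝓝 0) := by
      simpa using (hratio.mul hinv).const_mul ((2 + 2 * (Ns : ℝ)) * Ns ^ 2)
    refine squeeze_zero_norm (fun j => ?_) hb
    rw [norm_mul, Complex.norm_natCast]
    refine (mul_le_mul_of_nonneg_left (hrle j) (Nat.cast_nonneg _)).trans_eq ?_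
    ring
  have hg : Tendsto (fun j => corrCharFun t (d j) - 1) atTop (𝓝 0) := by
    have h := hr0.add ((hinvC.mul_const θ).const_mul (Ns : ℂ))
    simp only [zero_mul, mul_zero, add_zero] at h
    exact h.congr fun j => by simp [hr]
  have hKg : Tendsto (fun j => ((K j - 1 : ℕ) : ℂ) * (corrCharFun t (d j) - 1)) atTop
      (𝓝 ((Ns ^ 2 * β : ℝ) * θ)) := by
    have h := hKr.add ((hratioC.mul_const θ).const_mul (Ns : ℂ))
    have e : (0 : ℂ) + Ns * (Ns * β * θ) = (Ns ^ 2 * β : ℝ) * θ := by push_cast; ring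
    rw [e] at h
    refine h.congr fun j => ?_
    simp only [hr]
    ring
  exact (tendsto_one_add_pow_exp hg hKg).congr fun j => by rw [add_sub_cancel]

theorem charFun_map_div_poissonMeasure (r : ℝ≥0) (a t : ℝ) :
    charFun ((poissonMeasure r).map (fun k : ℕ => (k : ℝ) / a)) t
      = Complex.exp (r * (Complex.exp ((t / a : ℝ) * Complex.I) - 1)) := by
  have h : (poissonMeasure r).map (fun k : ℕ => (k : ℝ) / a)
      = ((poissonMeasure r).map (Nat.cast : ℕ → ℝ)).map (fun x => a⁻¹ • x) := by
    rw [Measure.map_map (by fun_prop) .of_discrete]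
    congr 1
    ext k
    simp [div_eq_inv_mul]
  rw [h, charFun_map_smul, charFun_map_cast_poissonMeasure]
  simp [div_eq_inv_mul]

theorem tendstoInDistribution_interferenceEnergy {Ns : ℕ} (hNs : 0 < Ns) {β : ℝ≥0} {Nh K : ℕ → ℕ}
    [∀ j, NeZero (Nh j)] (hNh : Tendsto Nh atTop atTop)
    (hload : Tendsto (fun j => (K j : ℝ) / ((Ns * Nh j : ℕ) : ℝ)) atTop (𝓝 (β : ℝ)))
    {Ω : ℕ → Type*} [∀ j, MeasurableSpace (Ω j)]
    (P : ∀ j, Measure (Ω j)) [∀ j, IsProbabilityMeasure (P j)]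
    (S : ∀ j, Ω j → Matrix (Fin (Ns * Nh j)) (Fin (K j)) ℝ) (hS : ∀ j, Measurable (S j))
    (hlaw : ∀ j, (P j).map (S j) = thMatrixLaw Ns (Nh j) (K j)) (u : ∀ j, Fin (K j)) :
    TendstoInDistribution (fun j ω => interferenceEnergy (S j ω) (u j)) atTop
      (fun k : ℕ => (k : ℝ) / (Ns : ℝ) ^ 2) P (poissonMeasure ((Ns : ℝ≥0) ^ 2 * β)) := by
  have hm : ∀ j, Measurable (fun ω => interferenceEnergy (S j ω) (u j)) := fun j =>
    (measurable_interferenceEnergy (u j)).comp (hS j)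
  refine ⟨fun j => (hm j).aemeasurable, Measurable.of_discrete.aemeasurable, ?_⟩
  refine ProbabilityMeasure.tendsto_of_tendsto_charFun fun t => ?_
  simp only [ProbabilityMeasure.coe_mk]
  rw [charFun_map_div_poissonMeasure]
  have hchar : ∀ j, charFun ((P j).map (fun ω => interferenceEnergy (S j ω) (u j))) t
      = ∫ M, Complex.exp ((interferenceEnergy M (u j) * t : ℝ) * Complex.I)
        ∂(thMatrixLaw Ns (Nh j) (K j)) := by
    intro j
    have hmE := measurable_interferenceEnergy (N := Ns * Nh j) (u j)
    rw [charFun_apply, integral_map (hm j).aemeasurable (by fun_prop), ← hlaw j,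
      integral_map (hS j).aemeasurable (by fun_prop)]
    simp [mul_comm]
  simp_rw [hchar]
  set z := Complex.exp (((Ns : ℝ≥0) ^ 2 * β : ℝ≥0) *
    (Complex.exp ((t / (Ns : ℝ) ^ 2 : ℝ) * Complex.I) - 1)) with hz
  -- Taking the worst sequence of user `u` in each system replaces the average over `d` by a single
  -- power.
  choose d hd using fun j =>
    exists_norm_integral_exp_interferenceEnergy_sub_le (Ns := Ns) (Nh := Nh j) (u j) t z
  have hlim := tendsto_corrCharFun_pow hNs hNh hload (fun j => (u j).pos) t d
  have hz' : Complex.exp ((Ns ^ 2 * β : ℝ) *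
      (Complex.exp ((t / Ns ^ 2 : ℝ) * Complex.I) - 1)) = z := by
    rw [hz]
    push_cast
    rfl
  rw [hz', tendsto_iff_norm_sub_tendsto_zero] at hlim
  rw [tendsto_iff_norm_sub_tendsto_zero]
  exact squeeze_zero (fun _ => norm_nonneg _) hd hlim

/-! ### The rate as a function of the interference energy -/

/-- The rate in bits of the scalar Gaussian channel with signal-to-noise ratio `γ` and
interference energy `|x|`. -/
def rate (γ x : ℝ) : ℝ := Real.logb 2 (1 + γ / (1 + |x| * γ))

/-- The absolute value in `rate` keeps the inner denominator at least one on all of `ℝ`, which makes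
`rate γ` a bounded continuous test function. On energies, which are nonnegative, it changes nothing.
-/
theorem continuous_rate {γ : ℝ} (hγ : 0 ≤ γ) : Continuous (rate γ) := by
  unfold rate Real.logb
  refine Continuous.div_const (Continuous.log ?_ fun x => ?_) _
  · exact continuous_const.add (continuous_const.div (by fun_prop) fun x => by positivity)
  · positivity

theorem rate_nonneg {γ : ℝ} (hγ : 0 ≤ γ) (x : ℝ) : 0 ≤ rate γ x :=
  Real.logb_nonneg (by norm_num) (le_add_of_nonneg_right (by positivity))

theorem rate_le {γ : ℝ} (hγ : 0 ≤ γ) (x : ℝ) : rate γ x ≤ Real.logb 2 (1 + γ) := by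
  refine Real.logb_le_logb_of_le (by norm_num) (by positivity) ?_
  gcongr
  exact div_le_self hγ (le_add_of_nonneg_right (by positivity))

theorem norm_rate_le {γ : ℝ} (hγ : 0 ≤ γ) (x : ℝ) : ‖rate γ x‖ ≤ Real.logb 2 (1 + γ) := by
  rw [Real.norm_of_nonneg (rate_nonneg hγ x)]
  exact rate_le hγ x

/-- Boundedness of the rate makes it integrable for the Poisson law, which gives both convergence
and the value of the series. -/
theorem hasSum_poissonRateTerm (Ns : ℕ) (β : ℝ≥0) {γ : ℝ} (hγ : 0 ≤ γ) :
    HasSum (poissonRateTerm Ns β γ)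
      (∫ k : ℕ, rate γ ((k : ℝ) / (Ns : ℝ) ^ 2) ∂(poissonMeasure ((Ns : ℝ≥0) ^ 2 * β))) := by
  have hint : Integrable (fun k : ℕ => rate γ ((k : ℝ) / (Ns : ℝ) ^ 2))
      (poissonMeasure ((Ns : ℝ≥0) ^ 2 * β)) :=
    .of_bound Measurable.of_discrete.aestronglyMeasurable _
      (ae_of_all _ fun k => norm_rate_le hγ _)
  have h := hasSum_integral_poissonMeasure hint
  refine (funext fun k => ?_ : poissonRateTerm Ns β γ = _) ▸ h
  have hk : |(k : ℝ) / (Ns : ℝ) ^ 2| = (k : ℝ) / (Ns : ℝ) ^ 2 := abs_of_nonneg (by positivity)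
  rw [poissonRateTerm, rate, hk, smul_eq_mul]
  push_cast
  rfl

/-! ### The matched-filter mutual information -/

theorem measurable_matchedFilter_received {N K : ℕ} (u : Fin K) :
    Measurable (fun p : Matrix (Fin N) (Fin K) ℝ × (Fin K → ℂ) × (Fin N → ℂ) =>
      matchedFilter p.1 u (received p.1 p.2.1 p.2.2)) := by
  have hS : ∀ (i : Fin N) (k : Fin K), Measurable
      (fun p : Matrix (Fin N) (Fin K) ℝ × (Fin K → ℂ) × (Fin N → ℂ) => p.1 i k) := fun i k =>
    (measurable_entry i k).comp measurable_fst
  have hC : ∀ k : Fin K, Measurable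
      (fun p : Matrix (Fin N) (Fin K) ℝ × (Fin K → ℂ) × (Fin N → ℂ) => crossCorr p.1 u k) :=
    fun k => (measurable_crossCorr u k).comp measurable_fst
  simp_rw [matchedFilter_received, Fintype.sum_sum_type, Sum.elim_inl, Sum.elim_inr]
  refine (Finset.measurable_sum _ fun k _ => ?_).add (Finset.measurable_sum _ fun i _ => ?_)
  · exact (Complex.measurable_ofReal.comp (hC k)).mul
      ((measurable_pi_apply k).comp (measurable_fst.comp measurable_snd))
  · exact (Complex.measurable_ofReal.comp (hS i u)).mul
      ((measurable_pi_apply i).comp (measurable_snd.comp measurable_snd))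

theorem ae_crossCorr_self_eq_one {Ns Nh K : ℕ} (hNs : 0 < Ns) (u : Fin K) :
    ∀ᵐ S ∂(thMatrixLaw Ns Nh K), crossCorr S u u = 1 := by
  rw [thMatrixLaw_eq]
  refine (ae_map_iff Measurable.of_discrete.aemeasurable
    (measurable_crossCorr u u (measurableSet_singleton 1))).2 ?_
  exact ae_of_all _ fun c => crossCorr_thMatrix_self hNs c u

theorem sumfMutualInfo_eq {Ω : Type*} [MeasurableSpace Ω] {P : Measure Ω} [IsProbabilityMeasure P]
    {Ns Nh K : ℕ} (hNs : 0 < Ns) {E N₀ : ℝ≥0} (hE : 0 < E) (hN₀ : 0 < N₀)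
    {S : Ω → Matrix (Fin (Ns * Nh)) (Fin K) ℝ} {b : Ω → Fin K → ℂ} {n : Ω → Fin (Ns * Nh) → ℂ}
    (h : IsGaussianTHSystem P Ns Nh K E N₀ S b n) (u : Fin K) :
    sumfMutualInfo P S b n u
      = ENNReal.ofReal (∫ ω, rate ((E : ℝ) / N₀) (interferenceEnergy (S ω) u) ∂P) := by
  have hγ : 0 ≤ (E : ℝ) / N₀ := by positivity
  have hE' : 0 < (E : ℝ) := hE
  have hN' : 0 < (N₀ : ℝ) := hN₀
  have hlog2 : 0 < Real.log 2 := Real.log_pos (by norm_num)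
  have hmE := measurable_interferenceEnergy (N := Ns * Nh) u
  have hmr : Measurable (fun M : Matrix (Fin (Ns * Nh)) (Fin K) ℝ =>
      rate ((E : ℝ) / N₀) (interferenceEnergy M u)) := (continuous_rate hγ).measurable.comp hmE
  have hcond := condMutualInfo_eq_lintegral_of_indepFun h.measurable_matrix
    (h.measurable_symbols.prodMk h.measurable_noise) h.indep_matrix
    (measurable_matchedFilter_received u)
    (g := fun p : Matrix (Fin (Ns * Nh)) (Fin K) ℝ × (Fin K → ℂ) × (Fin (Ns * Nh) → ℂ) => p.2.1 u)
    ((measurable_pi_apply u).comp (measurable_fst.comp measurable_snd))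
  have hae : ∀ᵐ M ∂(P.map S), InformationTheory.klDiv
      (P.map (fun ω => (matchedFilter M u (received M (b ω) (n ω)), b ω u)))
      ((P.map (fun ω => matchedFilter M u (received M (b ω) (n ω)))).prod
        (P.map (fun ω => b ω u)))
      = ENNReal.ofReal (Real.log 2) *
        ENNReal.ofReal (rate ((E : ℝ) / N₀) (interferenceEnergy M u)) := by
    rw [h.law_matrix]
    filter_upwards [ae_crossCorr_self_eq_one hNs u] with M hM
    have hI := interferenceEnergy_nonneg M u
    rw [klDiv_matchedFilter hE.ne' hN₀.ne' h.measurable_symbols h.measurable_noise h.law_symbols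
      h.law_noise h.indep_symbols_noise M u hM, ← ENNReal.ofReal_mul hlog2.le, rate,
      abs_of_nonneg hI, Real.logb, mul_div_cancel₀ _ hlog2.ne']
    -- Dividing numerator and denominator by `N₀` turns `E / (x E + N₀)` into `γ / (1 + x γ)`.
    congr 3
    field_simp
    ring
  have hlog2' : ENNReal.ofReal (Real.log 2) ≠ 0 := by simpa using hlog2
  have hint : Integrable (fun ω => rate ((E : ℝ) / N₀) (interferenceEnergy (S ω) u)) P :=
    .of_bound (hmr.comp h.measurable_matrix).aestronglyMeasurable _
      (ae_of_all _ fun ω => norm_rate_le hγ _)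
  rw [sumfMutualInfo, hcond, lintegral_congr_ae hae,
    lintegral_const_mul _ hmr.ennreal_ofReal, ENNReal.mul_div_right_comm,
    ENNReal.div_self hlog2' ENNReal.ofReal_ne_top, one_mul,
    lintegral_map hmr.ennreal_ofReal h.measurable_matrix,
    ofReal_integral_eq_lintegral_ofReal hint (ae_of_all _ fun ω => rate_nonneg hγ _)]

/-- With no chips in a subgroup there are no codes, so the matrix law would be the zero measure
rather than a probability. -/
theorem neZero_of_isGaussianTHSystem {Ω : Type*} [MeasurableSpace Ω] {P : Measure Ω}
    [IsProbabilityMeasure P] {Ns Nh K : ℕ} (hNs : 0 < Ns) {E N₀ : ℝ≥0}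
    {S : Ω → Matrix (Fin (Ns * Nh)) (Fin K) ℝ} {b : Ω → Fin K → ℂ} {n : Ω → Fin (Ns * Nh) → ℂ}
    (h : IsGaussianTHSystem P Ns Nh K E N₀ S b n) (u : Fin K) : NeZero Nh := by
  refine ⟨?_⟩
  rintro rfl
  have hp := Measure.isProbabilityMeasure_map h.measurable_matrix.aemeasurable (μ := P)
  rw [h.law_matrix, thMatrixLaw_eq] at hp
  have hempty : IsEmpty (Fin K → Fin Ns → Fin 0 × Bool) :=
    ⟨fun c => (c u ⟨0, hNs⟩).1.elim0⟩
  have h1 := hp.measure_univ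
  rw [Measure.eq_zero_of_isEmpty (Measure.pi fun _ : Fin K => codeLaw Ns 0)] at h1
  simp at h1

end THCDMA

end

open THCDMA in
theorem theorem2 (Ns : ℕ) (hNs : 0 < Ns) (β : ℝ≥0) (E N₀ : ℝ≥0) (hE : 0 < E) (hN₀ : 0 < N₀)
    (γ : ℝ) (hγ : γ = (E : ℝ) / (N₀ : ℝ))
    (Nh K : ℕ → ℕ) (hNh : Tendsto Nh atTop atTop)
    (hload : Tendsto (fun j => (K j : ℝ) / ((Ns * Nh j : ℕ) : ℝ)) atTop (𝓝 (β : ℝ)))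
    {Ω : ℕ → Type*} [∀ j, MeasurableSpace (Ω j)]
    (P : ∀ j, Measure (Ω j)) [∀ j, IsProbabilityMeasure (P j)]
    (S : ∀ j, Ω j → Matrix (Fin (Ns * Nh j)) (Fin (K j)) ℝ)
    (b : ∀ j, Ω j → Fin (K j) → ℂ) (n : ∀ j, Ω j → Fin (Ns * Nh j) → ℂ)
    (hsys : ∀ j, THCDMA.IsGaussianTHSystem (P j) Ns (Nh j) (K j) E N₀ (S j) (b j) (n j))
    (u : ∀ j, Fin (K j)) :
    (∀ j, THCDMA.sumfMutualInfo (P j) (S j) (b j) (n j) (u j) ≠ ∞) ∧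
    Summable (THCDMA.poissonRateTerm Ns β γ) ∧
    Tendsto (fun j => (THCDMA.sumfMutualInfo (P j) (S j) (b j) (n j) (u j)).toReal) atTop
      (𝓝 (∑' k, THCDMA.poissonRateTerm Ns β γ k)) ∧
    Tendsto (fun j => (K j : ℝ) / ((Ns * Nh j : ℕ) : ℝ) *
        (THCDMA.sumfMutualInfo (P j) (S j) (b j) (n j) (u j)).toReal) atTop
      (𝓝 ((β : ℝ) * ∑' k, THCDMA.poissonRateTerm Ns β γ k)) ∧
    TendstoInDistribution (fun j ω => THCDMA.interferenceEnergy (S j ω) (u j)) atTop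
      (fun k : ℕ => (k : ℝ) / (Ns : ℝ) ^ 2) P (poissonMeasure ((Ns : ℝ≥0) ^ 2 * β)) := by
  have hγ0 : 0 ≤ γ := by rw [hγ]; positivity
  have : ∀ j, NeZero (Nh j) := fun j => neZero_of_isGaussianTHSystem hNs (hsys j) (u j)
  have hdist := tendstoInDistribution_interferenceEnergy hNs hNh hload P S
    (fun j => (hsys j).measurable_matrix) (fun j => (hsys j).law_matrix) u
  have hinfo : ∀ j, sumfMutualInfo (P j) (S j) (b j) (n j) (u j)
      = ENNReal.ofReal (∫ ω, rate γ (interferenceEnergy (S j ω) (u j)) ∂(P j)) := fun j => by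
    rw [hγ]
    exact sumfMutualInfo_eq hNs hE hN₀ (hsys j) (u j)
  have hreal : ∀ j, (sumfMutualInfo (P j) (S j) (b j) (n j) (u j)).toReal
      = ∫ x, rate γ x ∂((P j).map (fun ω => interferenceEnergy (S j ω) (u j))) := fun j => by
    rw [hinfo, ENNReal.toReal_ofReal (integral_nonneg fun ω => rate_nonneg hγ0 _),
      integral_map (hdist.forall_aemeasurable j) (continuous_rate hγ0).aestronglyMeasurable]
  have hsum := hasSum_poissonRateTerm Ns β hγ0
  have hlim : Tendsto (fun j => (sumfMutualInfo (P j) (S j) (b j) (n j) (u j)).toReal) atTop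
      (𝓝 (∑' k, poissonRateTerm Ns β γ k)) := by
    -- Convergence in distribution is tested on the bounded continuous function `rate γ`.
    have h := (ProbabilityMeasure.tendsto_iff_forall_integral_tendsto.1 hdist.tendsto)
      (BoundedContinuousFunction.ofNormedAddCommGroup (rate γ) (continuous_rate hγ0) _
        (norm_rate_le hγ0))
    simp only [BoundedContinuousFunction.coe_ofNormedAddCommGroup, ProbabilityMeasure.coe_mk] at h
    rw [integral_map Measurable.of_discrete.aemeasurable
      (continuous_rate hγ0).aestronglyMeasurable] at h
    simp_rw [hreal]
    rwa [hsum.tsum_eq]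
  exact ⟨fun j => by rw [hinfo]; exact ENNReal.ofReal_ne_top, hsum.summable, hlim,
    hload.mul hlim, hdist⟩
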